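/- Let $\Gamma$ be a simple connected graph on $n$ vertices (finite, undirected, no loops or multiple edges). Let $L=D-A$ be its combinatorial Laplacian, where $D$ is the diagonal matrix of vertex degrees and $A$ is the adjacency matrix; let $\lambda_i$ be the eigenvalues of $L$, listed with multiplicity, and let $\mathbf{G}$ be the Moore–Penrose pseudoinverse of $L$ (the combinatorial Green's function of $\Gamma$). A rooted $2$-forest is a digraph whose underlying undirected graph (as a multigraph, so that no two vertices are joined by arcs in both directions) has no cycles and exactly two connected components, and in which each weakly connected component has a root, that is, a vertex to which every vertex of the component has a unique directed path. Let $\mathbb{F}_2^*$ be the set of rooted $2$-forests on the whole vertex set of $\Gamma$ each of whose arcs is an edge of $\Gamma$ with one of its two orientations, and let $\tau$ be the number of spanning trees of $\Gamma$. Then $$\operatorname{Tr}(\mathbf{G})=\sum_{\lambda_i\neq 0}\frac{1}{\lambda_i}=\frac{|\mathbb{F}_2^*|}{n\tau}.$$ -/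

import Mathlib

/-! ## The Moore–Penrose pseudoinverse of a real matrix -/

namespace Matrix

/-- `P` satisfies the four Penrose equations for the real matrix `M`. -/
structure IsMoorePenroseInverse {m n : Type*} [Fintype m] [Fintype n]
    (M : Matrix m n ℝ) (P : Matrix n m ℝ) : Prop where
  mul_mul_self : M * P * M = M
  mul_mul_inv : P * M * P = P
  symm_left : (M * P)ᵀ = M * P
  symm_right : (P * M)ᵀ = P * M

theorem IsMoorePenroseInverse.unique {m n : Type*} [Fintype m] [Fintype n]
    {M : Matrix m n ℝ} {P Q : Matrix n m ℝ}
    (hP : M.IsMoorePenroseInverse P) (hQ : M.IsMoorePenroseInverse Q) : P = Q := by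
  have h1 : M * P = M * Q := by
    calc M * P = (M * Q * M) * P := by rw [hQ.mul_mul_self]
      _ = (M * Q) * (M * P) := by simp only [Matrix.mul_assoc]
      _ = (M * Q)ᵀ * (M * P)ᵀ := by rw [hQ.symm_left, hP.symm_left]
      _ = ((M * P * M) * Q)ᵀ := by rw [← transpose_mul]; simp only [Matrix.mul_assoc]
      _ = M * Q := by rw [hP.mul_mul_self, hQ.symm_left]
  have h2 : P * M = Q * M := by
    calc P * M = P * (M * Q * M) := by rw [hQ.mul_mul_self]
      _ = (P * M) * (Q * M) := by simp only [Matrix.mul_assoc]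
      _ = (P * M)ᵀ * (Q * M)ᵀ := by rw [hQ.symm_right, hP.symm_right]
      _ = (Q * (M * P * M))ᵀ := by rw [← transpose_mul]; simp only [Matrix.mul_assoc]
      _ = Q * M := by rw [hP.mul_mul_self, hQ.symm_right]
  calc P = P * M * P := hP.mul_mul_inv.symm
    _ = Q * (M * P) := by rw [h2, Matrix.mul_assoc]
    _ = Q * M * Q := by rw [h1, Matrix.mul_assoc]
    _ = Q := hQ.mul_mul_inv

theorem exists_isMoorePenroseInverse_of_isHermitian {n : Type*} [Fintype n]
    {M : Matrix n n ℝ} (hM : M.IsHermitian) :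
    ∃ P : Matrix n n ℝ, M.IsMoorePenroseInverse P ∧ Pᵀ = P := by
  classical
  let U : Matrix n n ℝ := hM.eigenvectorUnitary
  let d : n → ℝ := hM.eigenvalues
  have hU : Uᵀ * U = 1 := by
    have := Unitary.coe_star_mul_self hM.eigenvectorUnitary
    rwa [star_eq_conjTranspose, conjTranspose_eq_transpose_of_trivial] at this
  have hS : M = U * diagonal d * Uᵀ := by
    have := hM.spectral_theorem
    rw [Unitary.conjStarAlgAut_apply, star_eq_conjTranspose,
      conjTranspose_eq_transpose_of_trivial] at this
    exact this
  have key : ∀ a b : n → ℝ, (U * diagonal a * Uᵀ) * (U * diagonal b * Uᵀ) =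
      U * diagonal (fun i => a i * b i) * Uᵀ := by
    intro a b
    calc (U * diagonal a * Uᵀ) * (U * diagonal b * Uᵀ)
        = U * diagonal a * (Uᵀ * U) * diagonal b * Uᵀ := by simp only [Matrix.mul_assoc]
      _ = _ := by rw [hU, Matrix.mul_one, Matrix.mul_assoc U, diagonal_mul_diagonal]
  have keyT : ∀ a : n → ℝ, (U * diagonal a * Uᵀ)ᵀ = U * diagonal a * Uᵀ := by
    intro a
    simp [transpose_mul, Matrix.mul_assoc]
  refine ⟨U * diagonal (fun i => (d i)⁻¹) * Uᵀ, ⟨?_, ?_, ?_, ?_⟩, keyT _⟩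
  · rw [hS, key, key]
    congr 3
    funext i
    exact mul_inv_mul_cancel (d i)
  · rw [hS, key, key]
    congr 3
    funext i
    by_cases h : d i = 0
    · rw [h, _root_.inv_zero, mul_zero]
    · rw [inv_mul_cancel₀ h, one_mul]
  · rw [hS, key, keyT]
  · rw [hS, key, keyT]

theorem exists_isMoorePenroseInverse {m n : Type*} [Fintype m] [Fintype n]
    (M : Matrix m n ℝ) : ∃ P : Matrix n m ℝ, M.IsMoorePenroseInverse P := by
  classical
  have hN : (Mᵀ * M).IsHermitian := by
    have := isHermitian_conjTranspose_mul_self M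
    rwa [conjTranspose_eq_transpose_of_trivial] at this
  obtain ⟨Q, hQ, hQs⟩ := exists_isMoorePenroseInverse_of_isHermitian hN
  refine ⟨Q * Mᵀ, ⟨?_, ?_, ?_, ?_⟩⟩
  · have h0 : (M * (Q * Mᵀ) * M - M)ᵀ * (M * (Q * Mᵀ) * M - M) = 0 := by
      have e : Mᵀ * (M * (Q * Mᵀ) * M - M) = 0 := by
        have := hQ.mul_mul_self
        rw [Matrix.mul_sub, sub_eq_zero]
        simpa only [Matrix.mul_assoc] using this
      have f : M * (Q * Mᵀ) * M - M = M * (Q * Mᵀ * M - 1) := by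
        rw [Matrix.mul_sub, Matrix.mul_one]; simp only [Matrix.mul_assoc]
      nth_rewrite 1 [f]
      rw [transpose_mul, Matrix.mul_assoc, e, Matrix.mul_zero]
    rw [← conjTranspose_eq_transpose_of_trivial, conjTranspose_mul_self_eq_zero] at h0
    exact sub_eq_zero.mp h0
  · calc Q * Mᵀ * M * (Q * Mᵀ) = (Q * (Mᵀ * M) * Q) * Mᵀ := by simp only [Matrix.mul_assoc]
      _ = Q * Mᵀ := by rw [hQ.mul_mul_inv]
  · simp [transpose_mul, hQs, Matrix.mul_assoc]
  · have := hQ.symm_right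
    simpa only [Matrix.mul_assoc] using this

/-- The Moore–Penrose pseudoinverse of a real matrix: the unique solution of the Penrose
equations. -/
noncomputable def moorePenroseInverse {m n : Type*} [Fintype m] [Fintype n]
    (M : Matrix m n ℝ) : Matrix n m ℝ :=
  Classical.choose M.exists_isMoorePenroseInverse

theorem moorePenroseInverse_spec {m n : Type*} [Fintype m] [Fintype n]
    (M : Matrix m n ℝ) : M.IsMoorePenroseInverse M.moorePenroseInverse :=
  Classical.choose_spec M.exists_isMoorePenroseInverse

end Matrix

/-! ## Rooted forests -/

namespace Digraph

/-- `p` is the list of vertices of a directed path (without repeated vertices)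
from `u` to `v` in `F`; the path `[u]` of length zero from `u` to itself is allowed. -/
def IsDirectedPath {V : Type*} (F : Digraph V) (u v : V) (p : List V) : Prop :=
  p.head? = some u ∧ p.getLast? = some v ∧ p.IsChain F.Adj ∧ p.Nodup

/-- A rooted `k`-forest on the vertex set `V`: a digraph whose underlying undirected graph is a
`k`-forest (it has no cycles and exactly `k` connected components), and in which every weakly
connected component has a root, i.e. a vertex to which every vertex of the component has a
unique directed path. The field `asymm` says that there are no loops and that no edge is present
in both directions, which would be cycles of length one and two of the underlying graph and are
invisible in the simple graph `F.toSimpleGraphInclusive`. -/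
structure IsRootedForest {V : Type*} (F : Digraph V) (k : ℕ) : Prop where
  asymm : ∀ u v, F.Adj u v → ¬ F.Adj v u
  acyclic : F.toSimpleGraphInclusive.IsAcyclic
  card_components : Nat.card F.toSimpleGraphInclusive.ConnectedComponent = k
  exists_root : ∀ c : F.toSimpleGraphInclusive.ConnectedComponent,
    ∃ r ∈ c.supp, ∀ v ∈ c.supp, ∃! p : List V, F.IsDirectedPath v r p

end Digraph

namespace SimpleGraph

/-- The combinatorial Green's function of a graph: the Moore–Penrose pseudoinverse of its
combinatorial Laplacian `L = D - A`. -/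
noncomputable def greenFunction {V : Type*} [Fintype V] [DecidableEq V]
    (G : SimpleGraph V) [DecidableRel G.Adj] : Matrix V V ℝ :=
  (G.lapMatrix ℝ).moorePenroseInverse

/-- The set of spanning trees of `G`; an element is a tree on the whole vertex set `V`
all of whose edges are edges of `G`. -/
def spanningTrees {V : Type*} (G : SimpleGraph V) : Set (SimpleGraph V) :=
  {T | T ≤ G ∧ T.IsTree}

/-- The set of spanning rooted `k`-forests of `G`; an element is a rooted `k`-forest on the
whole vertex set `V`, every arc of which is an edge of `G` with one of its two directions. -/
def rootedSpanningForests {V : Type*} (G : SimpleGraph V) (k : ℕ) : Set (Digraph V) :=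
  {F | (∀ u v, F.Adj u v → G.Adj u v) ∧ F.IsRootedForest k}

end SimpleGraph

/-! Everything is read off the polynomial `det (x + L) = ∏ (x + λᵢ)`. Its constant coefficient
vanishes, so some eigenvalue is zero. If the coefficient of `x` is nonzero, it is the product of the
remaining eigenvalues, and the quotient of the coefficient of `x²` by it is the sum of their
inverses, which is the trace of the pseudoinverse.

The coefficients are counted by the matrix forest theorem, `det_smul_one_add_lapMatrix`. Row `v` of
`x + L` is `x e_v` plus the sum of `e_v - e_w` over the neighbours `w` of `v`. Multilinearity turns
the determinant into a sum over maps `f : V → Option V` along edges, and such a map contributes `x`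
to the number of its roots if following parents terminates, and `0` otherwise. So the coefficient of
`x ^ k` counts forest maps with `k` roots.

These maps are exactly the rooted `k`-forests. For `k = 1` they amount to a spanning tree with a
chosen root, which gives `n * τ`. -/

/-- A parent map on `V`, sending each root to `none`, is a forest map if following parents
always terminates. -/
def IsForestMap {V : Type*} (f : V → Option V) : Prop :=
  WellFounded fun w v => f v = some w

namespace SimpleGraph

/-- The forest maps with `k` roots all of whose arcs `v → f v` are edges of `G`. -/
def forestMaps {V : Type*} (G : SimpleGraph V) (k : ℕ) : Set (V → Option V) :=
  {f | IsForestMap f ∧ (∀ v w, f v = some w → G.Adj v w) ∧ {v | f v = none}.ncard = k}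

end SimpleGraph

/-! ### Determinant and pseudoinverse trace in terms of eigenvalues -/

namespace Matrix.IsHermitian

theorem det_smul_one_add {n : Type*} [Fintype n] [DecidableEq n] {M : Matrix n n ℝ}
    (hM : M.IsHermitian) (x : ℝ) :
    (x • (1 : Matrix n n ℝ) + M).det = ∏ i, (x + hM.eigenvalues i) := by
  have h : x • (1 : Matrix n n ℝ) + M = -(Matrix.scalar n (-x) - M) := by
    rw [Matrix.scalar_apply, ← Matrix.smul_one_eq_diagonal, neg_smul]
    abel
  rw [h, Matrix.det_neg, ← Matrix.eval_charpoly, hM.charpoly_eq, Polynomial.eval_prod,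
    ← Finset.card_univ, ← Finset.prod_const, ← Finset.prod_mul_distrib]
  refine Finset.prod_congr rfl fun i _ => ?_
  simp
  ring

/-- Inverting the diagonal of a spectral decomposition solves the Penrose equations. The convention
`0⁻¹ = 0` makes this valid for singular matrices. -/
theorem trace_moorePenroseInverse {n : Type*} [Fintype n] [DecidableEq n] {M : Matrix n n ℝ}
    (hM : M.IsHermitian) : M.moorePenroseInverse.trace = ∑ i, (hM.eigenvalues i)⁻¹ := by
  let U : Matrix n n ℝ := hM.eigenvectorUnitary
  let d : n → ℝ := hM.eigenvalues
  have hU : Uᵀ * U = 1 := by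
    have := Unitary.coe_star_mul_self hM.eigenvectorUnitary
    rwa [star_eq_conjTranspose, conjTranspose_eq_transpose_of_trivial] at this
  have hS : M = U * diagonal d * Uᵀ := by
    have := hM.spectral_theorem
    rw [Unitary.conjStarAlgAut_apply, star_eq_conjTranspose,
      conjTranspose_eq_transpose_of_trivial] at this
    exact this
  have key : ∀ a b : n → ℝ, (U * diagonal a * Uᵀ) * (U * diagonal b * Uᵀ) =
      U * diagonal (fun i => a i * b i) * Uᵀ := by
    intro a b
    calc (U * diagonal a * Uᵀ) * (U * diagonal b * Uᵀ)
        = U * diagonal a * (Uᵀ * U) * diagonal b * Uᵀ := by simp only [Matrix.mul_assoc]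
      _ = _ := by rw [hU, Matrix.mul_one, Matrix.mul_assoc U, diagonal_mul_diagonal]
  have keyT : ∀ a : n → ℝ, (U * diagonal a * Uᵀ)ᵀ = U * diagonal a * Uᵀ := by
    intro a
    simp [transpose_mul, Matrix.mul_assoc]
  have hP : M.IsMoorePenroseInverse (U * diagonal (fun i => (d i)⁻¹) * Uᵀ) := by
    refine ⟨?_, ?_, ?_, ?_⟩
    · rw [hS, key, key]
      congr 3
      funext i
      exact mul_inv_mul_cancel (d i)
    · rw [hS, key, key]
      congr 3
      funext i
      simpa using mul_inv_mul_cancel (d i)⁻¹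
    · rw [hS, key, keyT]
    · rw [hS, key, keyT]
  rw [M.moorePenroseInverse_spec.unique hP, Matrix.mul_assoc, Matrix.trace_mul_comm,
    Matrix.mul_assoc, hU, Matrix.mul_one, Matrix.trace_diagonal]

end Matrix.IsHermitian

/-! ### Low coefficients of a product of linear factors -/

namespace Polynomial

theorem coeff_zero_prod_X_add_C {ι : Type*} (s : Finset ι) (a : ι → ℝ) :
    (∏ i ∈ s, (X + C (a i))).coeff 0 = ∏ i ∈ s, a i := by
  simp [coeff_zero_eq_eval_zero, eval_prod]

theorem coeff_one_prod_X_add_C {ι : Type*} (s : Finset ι) (a : ι → ℝ)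
    (ha : ∀ i ∈ s, a i ≠ 0) :
    (∏ i ∈ s, (X + C (a i))).coeff 1 = (∏ i ∈ s, a i) * ∑ i ∈ s, (a i)⁻¹ := by
  classical
  induction s using Finset.induction_on with
  | empty => simp [coeff_one]
  | insert i s hi ih =>
    have hai : a i ≠ 0 := ha i (Finset.mem_insert_self i s)
    rw [Finset.prod_insert hi, Finset.prod_insert hi, Finset.sum_insert hi, add_mul, coeff_add,
      coeff_X_mul, coeff_C_mul, ih fun j hj => ha j (Finset.mem_insert_of_mem hj),
      coeff_zero_prod_X_add_C]
    field_simp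

/-- `h0` supplies an index with `a j = 0`, whose factor is `X`. After removing it, `h1` says that
the other `a i` are nonzero, and the lowest two coefficients of the quotient give the sum; the term
at `j` is `0⁻¹ = 0`. -/
theorem sum_inv_eq_coeff_two_div_coeff_one {ι : Type*} [Fintype ι] (a : ι → ℝ)
    (h0 : (∏ i, (X + C (a i))).coeff 0 = 0) (h1 : (∏ i, (X + C (a i))).coeff 1 ≠ 0) :
    ∑ i, (a i)⁻¹ = (∏ i, (X + C (a i))).coeff 2 / (∏ i, (X + C (a i))).coeff 1 := by
  classical
  rw [coeff_zero_prod_X_add_C, Finset.prod_eq_zero_iff] at h0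
  obtain ⟨j, -, hj⟩ := h0
  have hP : ∏ i, (X + C (a i)) = X * ∏ i ∈ Finset.univ.erase j, (X + C (a i)) := by
    rw [← Finset.mul_prod_erase _ _ (Finset.mem_univ j), hj, C_0, add_zero]
  rw [hP, coeff_X_mul, coeff_zero_prod_X_add_C] at h1
  have hne : ∀ i ∈ Finset.univ.erase j, a i ≠ 0 := Finset.prod_ne_zero_iff.mp h1
  rw [hP, coeff_X_mul, coeff_X_mul, coeff_zero_prod_X_add_C, coeff_one_prod_X_add_C _ _ hne,
    mul_div_cancel_left₀ _ h1, ← Finset.add_sum_erase _ _ (Finset.mem_univ j), hj, inv_zero,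
    zero_add]

end Polynomial

/-! ### Determinants of parent maps -/

/-- The matrix whose row at `v` is `x • e_v` if `v` is a root of `f`, and `e_v - e_w` if `w` is
the parent of `v`. -/
def parentMatrix {V : Type*} [DecidableEq V] (x : ℝ) (f : V → Option V) : Matrix V V ℝ :=
  Matrix.of fun v => (f v).elim (x • Pi.single v 1) fun w => Pi.single v 1 - Pi.single w 1

theorem parentMatrix_apply_none {V : Type*} [DecidableEq V] {x : ℝ} {f : V → Option V} {v : V} (h : f v = none) (u : V) :
    parentMatrix x f v u = x * (Pi.single v 1 : V → ℝ) u := by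
  simp [parentMatrix, h]

theorem parentMatrix_apply_some {V : Type*} [DecidableEq V] {x : ℝ} {f : V → Option V} {v w : V} (h : f v = some w) (u : V) :
    parentMatrix x f v u = (Pi.single v 1 : V → ℝ) u - (Pi.single w 1 : V → ℝ) u := by
  simp [parentMatrix, h]

/-- Parents have smaller well-founded rank, so ordering the vertices by rank makes the matrix
triangular, with `x` on the diagonal at roots and `1` elsewhere. -/
theorem IsForestMap.det_parentMatrix {V : Type*} [Fintype V] [DecidableEq V]
    {f : V → Option V} (hf : IsForestMap f) (x : ℝ) :
    (parentMatrix x f).det = x ^ {v | f v = none}.ncard := by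
  classical
  have rank_lt : ∀ v w, f v = some w → (hf.apply w).rank < (hf.apply v).rank :=
    fun v w h => Acc.rank_lt_of_rel (hf.apply v) h
  have off : ∀ v u, v ≠ u → ¬ (hf.apply u).rank < (hf.apply v).rank →
      parentMatrix x f v u = 0 := by
    intro v u hvu hlt
    rcases h : f v with _ | w
    · rw [parentMatrix_apply_none h, Pi.single_eq_of_ne hvu.symm, mul_zero]
    · have hw : u ≠ w := by
        rintro rfl
        exact hlt (rank_lt v u h)
      rw [parentMatrix_apply_some h, Pi.single_eq_of_ne hvu.symm, Pi.single_eq_of_ne hw, sub_zero]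
  have diag : ∀ v, parentMatrix x f v v = if f v = none then x else 1 := by
    intro v
    rcases h : f v with _ | w
    · simp [parentMatrix_apply_none h]
    · have hw : v ≠ w := by
        rintro rfl
        exact lt_irrefl _ (rank_lt v v h)
      simp [parentMatrix_apply_some h, Pi.single_eq_of_ne hw]
  have tri : (parentMatrix x f).BlockTriangular fun v => OrderDual.toDual (hf.apply v).rank := by
    intro v u hlt
    have hlt' : (hf.apply v).rank < (hf.apply u).rank := hlt
    refine off v u ?_ hlt'.le.not_gt
    rintro rfl
    exact lt_irrefl _ hlt'
  rw [tri.det]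
  -- Distinct vertices may share a rank, but then neither is the parent of the other, so each block
  -- is diagonal.
  have block : ∀ a, ((parentMatrix x f).toSquareBlock
      (fun v => OrderDual.toDual (hf.apply v).rank) a).det =
      ∏ v : V with OrderDual.toDual (hf.apply v).rank = a, if f v = none then x else 1 := by
    intro a
    have hd : (parentMatrix x f).toSquareBlock
        (fun v => OrderDual.toDual (hf.apply v).rank) a =
        Matrix.diagonal fun v => if f v.1 = none then x else 1 := by
      ext v u
      rcases eq_or_ne v u with rfl | hvu
      · simp [Matrix.toSquareBlock_def, diag]
      · rw [Matrix.diagonal_apply_ne _ hvu]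
        refine off v u (Subtype.coe_injective.ne hvu) ?_
        have : (hf.apply v).rank = (hf.apply u).rank :=
          OrderDual.toDual.injective (v.2.trans u.2.symm)
        rw [this]
        exact lt_irrefl _
    rw [hd, Matrix.det_diagonal]
    exact (Finset.prod_subtype _ (by simp) fun v : V => if f v = none then x else 1).symm
  rw [Finset.prod_congr rfl fun a _ => block a,
    Finset.prod_fiberwise_of_maps_to (fun v _ => Finset.mem_image_of_mem _ (Finset.mem_univ v)),
    Finset.prod_ite, Finset.prod_const, Finset.prod_const_one, mul_one,
    Set.ncard_eq_toFinset_card']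
  congr 2
  ext v
  simp

/-- The indicator of the vertices from which following parents does not terminate lies in the
kernel: it vanishes at roots and agrees at a vertex and its parent. -/
theorem det_parentMatrix_of_not_isForestMap {V : Type*} [Fintype V] [DecidableEq V]
    {f : V → Option V} (hf : ¬ IsForestMap f) (x : ℝ) :
    (parentMatrix x f).det = 0 := by
  classical
  rw [← Matrix.exists_mulVec_eq_zero_iff]
  let acc : V → Prop := Acc fun w v => f v = some w
  refine ⟨fun v => if acc v then 0 else 1, ?_, ?_⟩
  · intro h
    refine hf ⟨fun v => ?_⟩
    by_contra hv
    simpa [acc, hv] using congrFun h v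
  · ext v
    rcases h : f v with _ | w
    · have hv : acc v := ⟨v, fun w hw => by simp [h] at hw⟩
      simp only [Matrix.mulVec, dotProduct, parentMatrix_apply_none h]
      refine Finset.sum_eq_zero fun u _ => ?_
      rcases eq_or_ne u v with rfl | hu <;> simp [*]
    · have hv : acc v ↔ acc w := by
        refine ⟨fun hv => hv.inv h, fun hw => ⟨v, fun u hu => ?_⟩⟩
        rw [h, Option.some.injEq] at hu
        exact hu ▸ hw
      simp only [Matrix.mulVec, dotProduct, parentMatrix_apply_some h]
      simp only [sub_mul, Finset.sum_sub_distrib, Pi.single_apply, ite_mul, one_mul, zero_mul,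
        Finset.sum_ite_eq', Finset.mem_univ, if_true, hv, sub_self,
        Pi.zero_apply]

/-! ### The matrix forest theorem -/

namespace SimpleGraph

variable {V : Type*} [Fintype V] [DecidableEq V] (G : SimpleGraph V) [DecidableRel G.Adj]

/-- Indexing the summands by `Option V` makes a choice of one summand per row the same thing as a
parent map. -/
theorem lapMatrix_row (x : ℝ) (v : V) :
    (x • (1 : Matrix V V ℝ) + G.lapMatrix ℝ) v =
      ∑ o : Option V, o.elim (x • Pi.single v 1)
        fun w => if G.Adj v w then Pi.single v 1 - Pi.single w 1 else 0 := by
  ext u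
  rw [Fintype.sum_option]
  have hdeg : (G.degree v : ℝ) = ∑ w : V, if G.Adj v w then 1 else 0 := by
    simp [Finset.sum_boole, ← card_neighborFinset_eq_degree, neighborFinset_eq_filter]
  have key : (∑ w : V, (if G.Adj v w then Pi.single v 1 - Pi.single w 1 else 0 : V → ℝ)) u =
      (G.degree v : ℝ) * (Pi.single v 1 : V → ℝ) u - if G.Adj v u then 1 else 0 := by
    rw [Finset.sum_apply, hdeg, Finset.sum_mul]
    have : (if G.Adj v u then (1 : ℝ) else 0) =
        ∑ w : V, if G.Adj v w then (Pi.single w 1 : V → ℝ) u else 0 := by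
      rw [Finset.sum_eq_single u]
      · simp
      · intro w _ hw
        simp [Pi.single_eq_of_ne hw.symm]
      · simp
    rw [this, ← Finset.sum_sub_distrib]
    refine Finset.sum_congr rfl fun w _ => ?_
    split_ifs <;> simp
  simp only [Option.elim_none, Option.elim_some, Pi.add_apply, key]
  simp [lapMatrix, degMatrix, Matrix.one_apply, Matrix.diagonal_apply, Pi.single_apply, eq_comm,
    adjMatrix_apply]

open Classical in
/-- The matrix forest theorem. -/
theorem det_smul_one_add_lapMatrix (x : ℝ) :
    (x • (1 : Matrix V V ℝ) + G.lapMatrix ℝ).det =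
      ∑ f : V → Option V with IsForestMap f ∧ ∀ v w, f v = some w → G.Adj v w,
        x ^ {v | f v = none}.ncard := by
  have h : (x • (1 : Matrix V V ℝ) + G.lapMatrix ℝ).det =
      Matrix.detRowAlternating.toMultilinearMap fun v => ∑ o : Option V,
        o.elim (x • Pi.single v (1 : ℝ))
          fun w => if G.Adj v w then Pi.single v 1 - Pi.single w 1 else 0 := by
    change Matrix.detRowAlternating (x • (1 : Matrix V V ℝ) + G.lapMatrix ℝ) = _
    refine congrArg _ ?_
    exact funext fun v => G.lapMatrix_row x v
  rw [h, MultilinearMap.map_sum, Finset.sum_filter]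
  refine Finset.sum_congr rfl fun f _ => ?_
  change Matrix.det _ = _
  by_cases hadj : ∀ v w, f v = some w → G.Adj v w
  · have hM : (fun v => (f v).elim (x • Pi.single v (1 : ℝ))
        fun w => if G.Adj v w then Pi.single v 1 - Pi.single w 1 else 0 : Matrix V V ℝ) =
        parentMatrix x f := by
      ext v u
      rcases hv : f v with _ | w
      · simp [parentMatrix_apply_none hv]
      · simp [parentMatrix_apply_some hv, hadj v w hv]
    rw [hM]
    by_cases hf : IsForestMap f
    · rw [hf.det_parentMatrix, if_pos ⟨hf, hadj⟩]
    · rw [det_parentMatrix_of_not_isForestMap hf, if_neg fun h => hf h.1]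
  -- A choice that leaves the edges of `G` picks a zero row.
  · rw [if_neg fun h => hadj h.2]
    push Not at hadj
    obtain ⟨v, w, hv, hvw⟩ := hadj
    exact Matrix.det_eq_zero_of_row_eq_zero v fun u => by simp [hv, hvw]

open Polynomial in
theorem coeff_prod_X_add_C_eigenvalues (k : ℕ) :
    (∏ i, (X + C ((G.isHermitian_lapMatrix ℝ).eigenvalues i))).coeff k =
      ((G.forestMaps k).ncard : ℝ) := by
  classical
  have h : ∏ i, (X + C ((G.isHermitian_lapMatrix ℝ).eigenvalues i)) =
      ∑ f : V → Option V with IsForestMap f ∧ ∀ v w, f v = some w → G.Adj v w,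
        (X : ℝ[X]) ^ {v | f v = none}.ncard := by
    refine Polynomial.funext fun x => ?_
    rw [eval_finsetSum, eval_prod]
    simp only [eval_add, eval_X, eval_C, eval_pow]
    rw [← Matrix.IsHermitian.det_smul_one_add, det_smul_one_add_lapMatrix]
  rw [h, finsetSum_coeff]
  simp only [coeff_X_pow]
  rw [Finset.sum_boole, Finset.filter_filter, forestMaps, Set.ncard_eq_toFinset_card']
  congr 2
  ext f
  simp [and_assoc, eq_comm]

end SimpleGraph

/-! ### Directed paths and digraphs of parent maps -/

namespace Digraph

theorem isDirectedPath_cons_cons {V : Type*} {F : Digraph V} {u v a b : V} {l : List V} :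
    F.IsDirectedPath u v (a :: b :: l) ↔
      a = u ∧ F.Adj a b ∧ a ∉ b :: l ∧ F.IsDirectedPath b v (b :: l) := by
  simp only [IsDirectedPath, List.head?_cons, Option.some.injEq, List.getLast?_cons_cons,
    List.isChain_cons_cons, List.nodup_cons (a := a)]
  tauto

theorem isDirectedPath_singleton {V : Type*} {F : Digraph V} {u v a : V} :
    F.IsDirectedPath u v [a] ↔ a = u ∧ a = v := by
  simp [IsDirectedPath]

theorem IsDirectedPath.exists_eq_cons {V : Type*} {F : Digraph V} {u v : V} {p : List V}
    (h : F.IsDirectedPath u v p) : ∃ l, p = u :: l := by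
  obtain ⟨h, -⟩ := h
  exact ⟨p.tail, List.eq_cons_of_mem_head? h⟩

theorem IsDirectedPath.exists_walk {V : Type*} {F : Digraph V}
    (hF : ∀ u v, F.Adj u v → ¬ F.Adj v u) {v : V} {p : List V} :
    ∀ {u : V}, F.IsDirectedPath u v p →
      ∃ q : F.toSimpleGraphInclusive.Walk u v, q.support = p := by
  induction p with
  | nil => rintro u ⟨h, -⟩; simp at h
  | cons a l ih =>
    intro u h
    rcases l with _ | ⟨b, l⟩
    · obtain ⟨rfl, rfl⟩ := isDirectedPath_singleton.mp h
      exact ⟨.nil, rfl⟩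
    · obtain ⟨rfl, hab, -, h⟩ := isDirectedPath_cons_cons.mp h
      obtain ⟨q, hq⟩ := ih h
      have hne : a ≠ b := by
        rintro rfl
        exact hF _ _ hab hab
      have hadj : F.toSimpleGraphInclusive.Adj a b := ⟨hne, Or.inl hab⟩
      exact ⟨.cons hadj q, by rw [SimpleGraph.Walk.support_cons, hq]⟩

/-- The digraph with an arc from each vertex to its parent. -/
def ofParent {V : Type*} (f : V → Option V) : Digraph V where
  Adj v w := f v = some w

@[simp]
theorem ofParent_adj {V : Type*} {f : V → Option V} {v w : V} :
    (ofParent f).Adj v w ↔ f v = some w := Iff.rfl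

theorem ofParent_injective {V : Type*} :
    Function.Injective (ofParent : (V → Option V) → Digraph V) := by
  intro f g h
  ext v w
  exact iff_of_eq (congrFun (congrFun (congrArg Digraph.Adj h) v) w)

end Digraph

open Digraph

/-! ### From forest maps to rooted forests -/

namespace IsForestMap

variable {V : Type*} {f : V → Option V}

theorem rank_lt (hf : IsForestMap f) {v w : V} (h : f v = some w) :
    (hf.apply w).rank < (hf.apply v).rank :=
  Acc.rank_lt_of_rel (hf.apply v) h

theorem ne_some_self (hf : IsForestMap f) (v : V) : f v ≠ some v :=
  fun h => lt_irrefl _ (hf.rank_lt h)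

theorem asymm (hf : IsForestMap f) {v w : V} (h : f v = some w) : f w ≠ some v :=
  fun h' => lt_asymm (hf.rank_lt h) (hf.rank_lt h')

theorem adj_iff (hf : IsForestMap f) {v w : V} :
    (ofParent f).toSimpleGraphInclusive.Adj v w ↔ f v = some w ∨ f w = some v := by
  refine ⟨And.right, fun h => ⟨?_, h⟩⟩
  rintro rfl
  exact hf.ne_some_self v (or_self_iff.mp h)

/-- Being constant along arcs, `ρ` separates the connected components and identifies them with the
roots. -/
theorem exists_root_map (hf : IsForestMap f) :
    ∃ ρ : V → V, (∀ v, f (ρ v) = none) ∧ (∀ v, f v = none → ρ v = v) ∧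
      ∀ v w, f v = some w → ρ v = ρ w := by
  have key : ∀ v, ∃! r, f r = none ∧ Relation.ReflTransGen (fun v w => f v = some w) v r := by
    intro v
    induction v using hf.induction with
    | _ v ih =>
      rcases h : f v with _ | w
      · refine ⟨v, ⟨h, .refl⟩, ?_⟩
        rintro r ⟨-, hvr⟩
        rcases hvr.cases_head with rfl | ⟨w, hw, -⟩
        · rfl
        · rw [h] at hw
          exact absurd hw (by simp)
      · obtain ⟨r, ⟨hr, hwr⟩, huniq⟩ := ih w h
        refine ⟨r, ⟨hr, .head h hwr⟩, ?_⟩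
        rintro s ⟨hs, hvs⟩
        rcases hvs.cases_head with rfl | ⟨u, hu, hus⟩
        · rw [h] at hs
          exact absurd hs (by simp)
        · rw [h, Option.some.injEq] at hu
          subst hu
          exact huniq s ⟨hs, hus⟩
  choose ρ hρ huniq using key
  refine ⟨ρ, fun v => (hρ v).1, fun v hv => (huniq v v ⟨hv, .refl⟩).symm, fun v w hvw => ?_⟩
  exact (huniq v (ρ w) ⟨(hρ w).1, .head hvw (hρ w).2⟩).symm

theorem reachable_root (hf : IsForestMap f) {ρ : V → V} (h0 : ∀ v, f v = none → ρ v = v)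
    (h1 : ∀ v w, f v = some w → ρ v = ρ w) (v : V) :
    (ofParent f).toSimpleGraphInclusive.Reachable v (ρ v) := by
  induction v using hf.induction with
  | _ v ih =>
    rcases h : f v with _ | w
    · rw [h0 v h]
    · rw [h1 v w h]
      exact (hf.adj_iff.mpr (Or.inl h)).reachable.trans (ih w h)

theorem root_eq_of_reachable (hf : IsForestMap f) {ρ : V → V}
    (h1 : ∀ v w, f v = some w → ρ v = ρ w) {v w : V}
    (h : (ofParent f).toSimpleGraphInclusive.Reachable v w) : ρ v = ρ w := by
  obtain ⟨p⟩ := h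
  induction p with
  | nil => rfl
  | cons hadj _ ih =>
    rw [← ih]
    rcases hf.adj_iff.mp hadj with h | h
    · exact h1 _ _ h
    · exact (h1 _ _ h).symm

/-- Every vertex is joined to the only root, and each edge is charged to its child endpoint, so a
connected graph with at most `|V| - 1` edges results. -/
theorem isTree [Finite V] (hf : IsForestMap f) (h : {v | f v = none}.ncard = 1) :
    (ofParent f).toSimpleGraphInclusive.IsTree := by
  obtain ⟨ρ, hρ, h0, h1⟩ := hf.exists_root_map
  obtain ⟨r, hr⟩ := Set.ncard_eq_one.mp h
  have hρr : ∀ v, ρ v = r := fun v => by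
    have : ρ v ∈ {v | f v = none} := hρ v
    rwa [hr] at this
  have hconn : (ofParent f).toSimpleGraphInclusive.Connected := by
    have : Nonempty V := ⟨r⟩
    refine ⟨fun v w => ?_⟩
    have hv := hf.reachable_root h0 h1 v
    have hw := hf.reachable_root h0 h1 w
    rw [hρr] at hv hw
    exact hv.trans hw.symm
  rw [SimpleGraph.isTree_iff_connected_and_card]
  refine ⟨hconn, le_antisymm ?_ hconn.card_vert_le_card_edgeSet_add_one⟩
  have hsub : (ofParent f).toSimpleGraphInclusive.edgeSet ⊆
      (fun v => s(v, (f v).getD v)) '' {v | f v = none}ᶜ := by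
    intro e
    induction e with
    | _ v w =>
      intro he
      rcases hf.adj_iff.mp he with h | h
      · exact ⟨v, by simp [h], by simp [h]⟩
      · exact ⟨w, by simp [h], by simp [h, Sym2.eq_swap]⟩
  have hle := (Set.ncard_le_ncard hsub).trans (Set.ncard_image_le (Set.toFinite _))
  have hcompl := Set.ncard_add_ncard_compl {v | f v = none}
  rw [Nat.card_coe_set_eq]
  omega

theorem isAcyclic [Finite V] (hf : IsForestMap f) :
    (ofParent f).toSimpleGraphInclusive.IsAcyclic := by
  classical
  rcases isEmpty_or_nonempty V with hV | ⟨⟨v₀⟩⟩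
  · exact .of_subsingleton
  obtain ⟨ρ, hρ, -⟩ := hf.exists_root_map
  let r := ρ v₀
  have hr : f r = none := hρ v₀
  -- Hanging all other roots below `r` gives a one-root forest map, so the graph of `f` is contained
  -- in a tree.
  let g : V → Option V := fun v => if v = r then none else some ((f v).getD r)
  have hgr : g r = none := if_pos rfl
  have hgv : ∀ v, v ≠ r → g v = some ((f v).getD r) := fun v hv => if_neg hv
  have hrAcc : Acc (fun w v => g v = some w) r := ⟨r, fun w hw => by simp [hgr] at hw⟩
  have hg : IsForestMap g := by
    refine ⟨fun v => ?_⟩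
    induction v using hf.induction with
    | _ v ih =>
      refine ⟨v, fun w hw => ?_⟩
      rcases eq_or_ne v r with rfl | hv
      · simp [hgr] at hw
      · rw [hgv v hv, Option.some.injEq] at hw
        rcases h : f v with _ | u
        · rw [h, Option.getD_none] at hw
          exact hw ▸ hrAcc
        · rw [h, Option.getD_some] at hw
          exact ih w (by rw [h, hw])
  have hroots : {v | g v = none} = {r} := by
    ext v
    rcases eq_or_ne v r with rfl | hv
    · simp [hgr]
    · simp [hgv v hv, hv]
  have htree := hg.isTree (by rw [hroots, Set.ncard_singleton])
  refine htree.isAcyclic.anti (toSimpleGraphInclusive_mono fun v w hvw => ?_)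
  have hvw' : f v = some w := hvw
  have hv : v ≠ r := by
    rintro rfl
    simp [hr] at hvw'
  change g v = some w
  simp [hgv v hv, hvw']

/-- The rank bound is carried through the induction because it shows that `v` does not recur on the
path from its parent. -/
theorem exists_isDirectedPath (hf : IsForestMap f) {ρ : V → V}
    (h0 : ∀ v, f v = none → ρ v = v) (h1 : ∀ v w, f v = some w → ρ v = ρ w) (v : V) :
    ∃ p, (ofParent f).IsDirectedPath v (ρ v) p ∧
      ∀ u ∈ p, (hf.apply u).rank ≤ (hf.apply v).rank := by
  induction v using hf.induction with
  | _ v ih =>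
    rcases h : f v with _ | w
    · exact ⟨[v], isDirectedPath_singleton.mpr ⟨rfl, (h0 v h).symm⟩, by simp⟩
    · obtain ⟨p, hp, hrank⟩ := ih w h
      obtain ⟨l, rfl⟩ := hp.exists_eq_cons
      refine ⟨v :: w :: l, isDirectedPath_cons_cons.mpr ⟨rfl, h, fun hv => ?_, ?_⟩, ?_⟩
      · exact (hf.rank_lt h).not_ge (hrank v hv)
      · rwa [h1 v w h]
      · rintro u (_ | ⟨_, hu⟩)
        · exact le_rfl
        · exact (hrank u hu).trans (hf.rank_lt h).le

theorem isDirectedPath_unique {r : V} (hr : f r = none) {p : List V} :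
    ∀ {q : List V} {v : V}, (ofParent f).IsDirectedPath v r p →
      (ofParent f).IsDirectedPath v r q → p = q := by
  induction p with
  | nil => rintro q v ⟨h, -⟩; simp at h
  | cons a p ih =>
    intro q v hp hq
    obtain ⟨q, rfl⟩ := hq.exists_eq_cons
    rcases p with _ | ⟨b, p⟩
    · obtain ⟨rfl, rfl⟩ := isDirectedPath_singleton.mp hp
      rcases q with _ | ⟨c, q⟩
      · rfl
      · have := (isDirectedPath_cons_cons.mp hq).2.1
        simp [hr] at this
    · obtain ⟨rfl, hab, -, hp⟩ := isDirectedPath_cons_cons.mp hp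
      rcases q with _ | ⟨c, q⟩
      · obtain ⟨-, rfl⟩ := isDirectedPath_singleton.mp hq
        simp [hr] at hab
      · obtain ⟨-, hac, -, hq⟩ := isDirectedPath_cons_cons.mp hq
        rw [ofParent_adj] at hab hac
        obtain rfl : b = c := by simpa [hab] using hac
        rw [ih hp hq]

theorem isRootedForest [Finite V] (hf : IsForestMap f) :
    (ofParent f).IsRootedForest {v | f v = none}.ncard := by
  obtain ⟨ρ, hρ, h0, h1⟩ := hf.exists_root_map
  refine ⟨fun u v h => hf.asymm h, hf.isAcyclic, ?_, fun c => ?_⟩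
  · rw [← Nat.card_coe_set_eq]
    refine (Nat.card_eq_of_bijective (fun r : {v | f v = none} =>
      (ofParent f).toSimpleGraphInclusive.connectedComponentMk r) ⟨?_, ?_⟩).symm
    · rintro ⟨r, hr⟩ ⟨s, hs⟩ hrs
      have := hf.root_eq_of_reachable h1 (SimpleGraph.ConnectedComponent.exact hrs)
      rw [h0 r hr, h0 s hs] at this
      exact Subtype.ext this
    · intro c
      induction c using SimpleGraph.ConnectedComponent.ind with
      | _ v =>
        exact ⟨⟨ρ v, hρ v⟩,
          SimpleGraph.ConnectedComponent.sound (hf.reachable_root h0 h1 v).symm⟩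
  · induction c using SimpleGraph.ConnectedComponent.ind with
    | _ v =>
      refine ⟨ρ v, SimpleGraph.ConnectedComponent.sound (hf.reachable_root h0 h1 v).symm,
        fun u hu => ?_⟩
      rw [← hf.root_eq_of_reachable h1 (SimpleGraph.ConnectedComponent.exact hu)]
      obtain ⟨p, hp, -⟩ := hf.exists_isDirectedPath h0 h1 u
      exact ⟨p, hp, fun q hq => isDirectedPath_unique (hρ u) hq hp⟩

/-- Induction outwards from the roots: if `w` is the parent of `v` under `f`, the edge `vw` cannot
be oriented `w → v` by `g`, since `g w = f w` already. -/
theorem eq_of_graph_eq (hf : IsForestMap f) {g : V → Option V} (hg : IsForestMap g)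
    (hroots : {v | f v = none} = {v | g v = none})
    (hgraph : (ofParent f).toSimpleGraphInclusive = (ofParent g).toSimpleGraphInclusive) :
    f = g := by
  funext v
  induction v using hf.induction with
  | _ v ih =>
    rcases h : f v with _ | w
    · have : v ∈ {v | f v = none} := h
      rw [hroots] at this
      exact this.symm
    · have hadj := hf.adj_iff.mpr (Or.inl h)
      rw [hgraph, hg.adj_iff, ← ih w h] at hadj
      exact (hadj.resolve_right (hf.asymm h)).symm

end IsForestMap

/-! ### From rooted forests to forest maps -/

/-- For an arc `v → w`, the path from `v` to its root is `v` followed by the path from `w`. Hence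
`w` is the second vertex of the path from `v`, and path length decreases along arcs. -/
theorem Digraph.IsRootedForest.exists_isForestMap {V : Type*} {F : Digraph V} {k : ℕ}
    (hF : F.IsRootedForest k) :
    ∃ f : V → Option V, IsForestMap f ∧ ofParent f = F ∧ {v | f v = none}.ncard = k := by
  choose r hr hpath using hF.exists_root
  let R : V → V := fun v => r (F.toSimpleGraphInclusive.connectedComponentMk v)
  have hex : ∀ v, ∃! p, F.IsDirectedPath v (R v) p := fun v => hpath _ v rfl
  choose P hP hPuniq using hex
  replace hP : ∀ v, F.IsDirectedPath v (R v) (P v) := hP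
  replace hPuniq : ∀ v p, F.IsDirectedPath v (R v) p → p = P v := hPuniq
  have key : ∀ v w, F.Adj v w → P v = v :: P w := by
    intro v w hvw
    have hadj : F.toSimpleGraphInclusive.Adj v w :=
      ⟨by rintro rfl; exact hF.asymm _ _ hvw hvw, Or.inl hvw⟩
    have hR : R v = R w :=
      congrArg r (SimpleGraph.ConnectedComponent.sound hadj.reachable)
    have hPw := hP w
    -- Otherwise an initial segment of `P w` runs from `w` to `v`; by acyclicity it is the single
    -- edge, so `w → v` is an arc beside `v → w`.
    have hnot : v ∉ P w := by
      intro hv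
      obtain ⟨s, t, hst⟩ := List.append_of_mem hv
      have hs : F.IsDirectedPath w v (s ++ [v]) := by
        obtain ⟨h1, -, h3, h4⟩ := hPw
        have hpre : s ++ [v] <+: P w := ⟨t, by simp [hst]⟩
        refine ⟨?_, by simp, h3.prefix hpre, h4.sublist hpre.sublist⟩
        rw [hst] at h1
        cases s <;> simpa using h1
      obtain ⟨q, hq⟩ := hs.exists_walk hF.asymm
      have hqp : q.IsPath := by
        rw [SimpleGraph.Walk.isPath_def, hq]
        exact hs.2.2.2
      have heq := (hF.acyclic.subsingleton_path w v).elim ⟨q, hqp⟩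
        (SimpleGraph.Path.singleton hadj.symm)
      have hsupp : s ++ [v] = [w, v] := by
        rw [← hq]
        have := congrArg (fun p : F.toSimpleGraphInclusive.Path w v => p.1.support) heq
        simpa [SimpleGraph.Path.singleton] using this
      rw [hsupp] at hs
      exact hF.asymm _ _ hvw (isDirectedPath_cons_cons.mp hs).2.1
    obtain ⟨l, hl⟩ := hPw.exists_eq_cons
    refine (hPuniq v _ ?_).symm
    rw [hR, hl, isDirectedPath_cons_cons, ← hl]
    exact ⟨rfl, hvw, hnot, hPw⟩
  let f : V → Option V := fun v => (P v)[1]?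
  have hadj : ∀ v w, f v = some w ↔ F.Adj v w := by
    intro v w
    refine ⟨fun h => ?_, fun h => ?_⟩
    · obtain ⟨l, hl⟩ := (hP v).exists_eq_cons
      have hl' : l.head? = some w := by simpa [f, hl, List.head?_eq_getElem?] using h
      obtain ⟨m, rfl⟩ : ∃ m, l = w :: m := ⟨l.tail, List.eq_cons_of_mem_head? hl'⟩
      have := hP v
      rw [hl] at this
      exact (isDirectedPath_cons_cons.mp this).2.1
    · simpa [f, key v w h, List.head?_eq_getElem?] using (hP w).1
  have hroot : ∀ v, f v = none ↔ R v = v := by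
    intro v
    obtain ⟨l, hl⟩ := (hP v).exists_eq_cons
    refine ⟨fun h => ?_, fun h => ?_⟩
    · obtain rfl : l = [] := by simpa [f, hl] using h
      have := hP v
      rw [hl] at this
      exact (isDirectedPath_singleton.mp this).2.symm
    · have := hPuniq v [v] (isDirectedPath_singleton.mpr ⟨rfl, h.symm⟩)
      simp [f, ← this]
  refine ⟨f, ?_, ?_, ?_⟩
  · refine Subrelation.wf ?_ (measure fun v => (P v).length).wf
    intro w v h
    change (P w).length < (P v).length
    simp [key v w ((hadj v w).mp h)]
  · ext v w
    exact hadj v w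
  · have hrange : {v | f v = none} = Set.range r := by
      ext v
      rw [Set.mem_ofPred_eq, hroot]
      refine ⟨fun h => ⟨_, h⟩, ?_⟩
      rintro ⟨c, rfl⟩
      exact congrArg r (hr c)
    have hinj : Function.Injective r := fun c d h => by
      have hc := hr c
      rw [h] at hc
      exact hc.symm.trans (hr d)
    rw [hrange, ← Nat.card_coe_set_eq, Nat.card_range_of_injective hinj, hF.card_components]

/-! ### Counting rooted forests and spanning trees -/

namespace SimpleGraph

/-- Each non-root points to a neighbour closer to `r`. The graph obtained is connected and contained
in `T`, hence equal to it, since a tree is minimally connected. -/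
theorem IsTree.exists_isForestMap {V : Type*} [Finite V] {T : SimpleGraph V} (hT : T.IsTree)
    (r : V) : ∃ f : V → Option V, IsForestMap f ∧ {v | f v = none} = {r} ∧
      (ofParent f).toSimpleGraphInclusive = T := by
  classical
  have hex : ∀ v, v ≠ r → ∃ w, T.Adj v w ∧ T.dist w r < T.dist v r := by
    intro v hv
    obtain ⟨p, hp⟩ := hT.connected.exists_walk_length_eq_dist v r
    cases p with
    | nil => exact absurd rfl hv
    | cons h p =>
      refine ⟨_, h, ?_⟩
      rw [← hp, Walk.length_cons, Nat.lt_succ_iff]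
      exact dist_le p
  choose g hadj hdist using hex
  let f : V → Option V := fun v => if h : v = r then none else some (g v h)
  have hfr : f r = none := dif_pos rfl
  have hfv : ∀ v (h : v ≠ r), f v = some (g v h) := fun v h => dif_neg h
  have hroots : {v | f v = none} = {r} := by
    ext v
    rcases eq_or_ne v r with rfl | hv
    · simp [hfr]
    · simp [hfv v hv, hv]
  have hsome : ∀ v w, f v = some w → T.Adj v w ∧ T.dist w r < T.dist v r := by
    intro v w h
    rcases eq_or_ne v r with rfl | hv
    · simp [hfr] at h
    · obtain rfl : g v hv = w := by simpa [hfv v hv] using h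
      exact ⟨hadj v hv, hdist v hv⟩
  have hf : IsForestMap f :=
    Subrelation.wf (fun {w v} h => (hsome v w h).2) (measure fun v => T.dist v r).wf
  refine ⟨f, hf, hroots, ?_⟩
  have hle : (ofParent f).toSimpleGraphInclusive ≤ T := by
    intro v w h
    rcases hf.adj_iff.mp h with h | h
    · exact (hsome _ _ h).1
    · exact (hsome _ _ h).1.symm
  have hconn := (hf.isTree (by rw [hroots, Set.ncard_singleton])).connected
  exact le_antisymm hle ((isTree_iff_minimal_connected.mp hT).2 hconn hle)

variable {V : Type*} [Fintype V] (G : SimpleGraph V)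

theorem ncard_rootedSpanningForests (k : ℕ) :
    (G.rootedSpanningForests k).ncard = (G.forestMaps k).ncard := by
  have h : G.rootedSpanningForests k = ofParent '' G.forestMaps k := by
    ext F
    constructor
    · rintro ⟨hle, hF⟩
      obtain ⟨f, hf, rfl, hk⟩ := hF.exists_isForestMap
      exact ⟨f, ⟨hf, hle, hk⟩, rfl⟩
    · rintro ⟨f, ⟨hf, hle, rfl⟩, rfl⟩
      exact ⟨hle, hf.isRootedForest⟩
  rw [h, Set.ncard_image_of_injective _ ofParent_injective]

/-- A forest map with one root is determined by its root and underlying tree, and every such pair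
occurs. -/
theorem ncard_forestMaps_one :
    (G.forestMaps 1).ncard = Fintype.card V * G.spanningTrees.ncard := by
  let φ : (V → Option V) → Set V × SimpleGraph V := fun f =>
    ({v | f v = none}, (ofParent f).toSimpleGraphInclusive)
  have himage : φ '' G.forestMaps 1 = Set.range (singleton : V → Set V) ×ˢ G.spanningTrees := by
    ext ⟨S, T⟩
    constructor
    · rintro ⟨f, ⟨hf, hle, h1⟩, hφ⟩
      obtain ⟨rfl, rfl⟩ := Prod.mk.inj hφ
      obtain ⟨r, hr⟩ := Set.ncard_eq_one.mp h1
      refine ⟨⟨r, hr.symm⟩, fun v w h => ?_, hf.isTree h1⟩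
      rcases hf.adj_iff.mp h with h | h
      · exact hle _ _ h
      · exact (hle _ _ h).symm
    · rintro ⟨⟨r, hr⟩, hle, hT⟩
      obtain ⟨f, hf, hroots, rfl⟩ := hT.exists_isForestMap r
      refine ⟨f, ⟨hf, fun v w h => hle (hf.adj_iff.mpr (Or.inl h)), ?_⟩, ?_⟩
      · rw [hroots, Set.ncard_singleton]
      · exact Prod.ext (hroots.trans hr) rfl
  have hinj : Set.InjOn φ (G.forestMaps 1) := by
    rintro f ⟨hf, -⟩ g ⟨hg, -⟩ h
    obtain ⟨hroots, hgraph⟩ := Prod.mk.inj h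
    exact hf.eq_of_graph_eq hg hroots hgraph
  rw [← hinj.ncard_image, himage, Set.ncard_prod, ← Nat.card_coe_set_eq (Set.range _),
    Nat.card_range_of_injective Set.singleton_injective, Nat.card_eq_fintype_card]

theorem forestMaps_zero [Nonempty V] : G.forestMaps 0 = ∅ := by
  rw [Set.eq_empty_iff_forall_notMem]
  rintro f ⟨hf, -, h0⟩
  obtain ⟨ρ, hρ, -⟩ := hf.exists_root_map
  obtain ⟨v⟩ := ‹Nonempty V›
  have : ρ v ∈ {v | f v = none} := hρ v
  rw [(Set.ncard_eq_zero (Set.toFinite _)).mp h0] at this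
  exact this

theorem Connected.ncard_spanningTrees_ne_zero {G : SimpleGraph V} (hG : G.Connected) :
    G.spanningTrees.ncard ≠ 0 := by
  obtain ⟨T, hle, hT⟩ := hG.exists_isTree_le
  exact Set.ncard_ne_zero_of_mem (a := T) ⟨hle, hT⟩

end SimpleGraph

theorem corollary2 {V : Type*} [Fintype V] [DecidableEq V]
    (G : SimpleGraph V) [DecidableRel G.Adj] (hG : G.Connected)
    (n : ℕ) (hn : Fintype.card V = n) :
    G.greenFunction.trace =
        ∑ i : V with (G.isHermitian_lapMatrix ℝ).eigenvalues i ≠ 0,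
          1 / (G.isHermitian_lapMatrix ℝ).eigenvalues i ∧
      G.greenFunction.trace =
        ((G.rootedSpanningForests 2).ncard : ℝ) / ((n : ℝ) * (G.spanningTrees.ncard : ℝ)) := by
  have hV : Nonempty V := hG.nonempty
  rw [SimpleGraph.greenFunction, (G.isHermitian_lapMatrix ℝ).trace_moorePenroseInverse]
  constructor
  · simp only [one_div]
    rw [Finset.sum_filter]
    refine Finset.sum_congr rfl fun i _ => ?_
    split_ifs with h
    · rfl
    · rw [not_ne_iff.mp h, inv_zero]
  · rw [Polynomial.sum_inv_eq_coeff_two_div_coeff_one,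
      G.coeff_prod_X_add_C_eigenvalues, G.coeff_prod_X_add_C_eigenvalues,
      G.ncard_forestMaps_one, G.ncard_rootedSpanningForests, hn, Nat.cast_mul]
    -- The constant coefficient vanishes because every forest on a nonempty vertex set has a root.
    · rw [G.coeff_prod_X_add_C_eigenvalues, G.forestMaps_zero, Set.ncard_empty, Nat.cast_zero]
    · rw [G.coeff_prod_X_add_C_eigenvalues, G.ncard_forestMaps_one, Nat.cast_ne_zero]
      exact mul_ne_zero Fintype.card_ne_zero hG.ncard_spanningTrees_ne_zero
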